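/- Let $\mathcal H$ be a finite-dimensional complex Hilbert space and let $\rho,\sigma$ be density operators on $\mathcal H$ (positive semidefinite, trace one) with $\operatorname{Im}\rho\subset\operatorname{Im}\sigma$. For $n\ge 1$ a test is an operator $A_n$ on $\mathcal H^{\otimes n}$ with $0\le A_n\le 1$; put $\alpha_n(A_n)=\operatorname{Tr}\rho^{\otimes n}(1-A_n)$ and $\beta_n(A_n)=\operatorname{Tr}\sigma^{\otimes n}A_n$. For $0\le s\le 1$ and $\lambda\in\mathbb R$ let $$\psi(s)=\log\operatorname{Tr}\rho^{1+s}\sigma^{-s},\qquad \varphi(\lambda)=\max_{0\le s\le 1}\{\lambda s-\psi(s)\},$$ where $\sigma^{-s}$ is taken on the support of $\sigma$. Then for every $r\in\mathbb R$ the equation $\varphi(\lambda)=r-\lambda$ has exactly one real solution $\lambda^*$. For every sequence of tests $(A_n)$ with $$\limsup_{n\to\infty}\frac1n\log\beta_n(A_n)\le -r$$ (with $\log 0=-\infty$) one has $$\limsup_{n\to\infty}\frac1n\log\bigl(1-\alpha_n(A_n)\bigr)\le-\varphi(\lambda^*).$$ Moreover, $$\varphi(\lambda^*)=\max_{0\le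 s\le 1}\left\{\frac{s}{1+s}\,r-\frac{1}{1+s}\,\psi(s)\right\}.$$ -/

import Mathlib

noncomputable section

namespace QuantumTesting

open scoped ComplexOrder

/-- `ρ` is a density operator on the Hilbert space `ℂ^ι`: positive semidefinite (in particular
self-adjoint) and of trace one. -/
def IsDensity {ι : Type*} [Fintype ι] (ρ : Matrix ι ι ℂ) : Prop :=
  ρ.PosSemidef ∧ ρ.trace = 1

/-- The image (column space) of `ρ` is contained in that of `σ`. -/
def ImageLE {ι : Type*} [Fintype ι] (ρ σ : Matrix ι ι ℂ) : Prop :=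
  LinearMap.range ρ.mulVecLin ≤ LinearMap.range σ.mulVecLin

/-- The `n`-fold tensor power `ρ ⊗ ⋯ ⊗ ρ`, as an operator on `(ℂ^ι)^{⊗ n} = ℂ^(Fin n → ι)`,
written in the product basis. -/
def tensorPow {ι : Type*} (ρ : Matrix ι ι ℂ) (n : ℕ) : Matrix (Fin n → ι) (Fin n → ι) ℂ :=
  Matrix.of fun x y => ∏ k, ρ (x k) (y k)

/-- `A` is a test: `0 ≤ A ≤ 1` in the Loewner order. -/
def IsTest {κ : Type*} [DecidableEq κ] (A : Matrix κ κ ℂ) : Prop :=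
  A.PosSemidef ∧ (1 - A).PosSemidef

/-- Error probability of the first kind, `Tr ρ^{⊗ n} (1 - A)`. -/
def errFirst {ι : Type*} [Fintype ι] [DecidableEq ι] (ρ : Matrix ι ι ℂ) (n : ℕ)
    (A : Matrix (Fin n → ι) (Fin n → ι) ℂ) : ℝ :=
  ((tensorPow ρ n * (1 - A)).trace).re

/-- Error probability of the second kind, `Tr σ^{⊗ n} A`. -/
def errSecond {ι : Type*} [Fintype ι] [DecidableEq ι] (σ : Matrix ι ι ℂ) (n : ℕ)
    (A : Matrix (Fin n → ι) (Fin n → ι) ℂ) : ℝ :=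
  ((tensorPow σ n * A).trace).re

/-- The real power `ρ ^ t` of a positive semidefinite matrix, by functional calculus.
Since `0 ^ t = 0` for real `t ≠ 0`, a negative power is taken on the support of `ρ`
(inverse on the image, zero on the kernel). -/
def mpow {ι : Type*} [Fintype ι] [DecidableEq ι] (ρ : Matrix ι ι ℂ) (t : ℝ) : Matrix ι ι ℂ :=
  cfc (fun x : ℝ => x ^ t) ρ

/-- `ψ(s) = log Tr ρ^{1+s} σ^{-s}`. -/
def psi {ι : Type*} [Fintype ι] [DecidableEq ι] (ρ σ : Matrix ι ι ℂ) (s : ℝ) : ℝ :=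
  Real.log ((mpow ρ (1 + s) * mpow σ (-s)).trace).re

/-- `φ(l) = max_{0 ≤ s ≤ 1} (l s - ψ(s))`. When the image of `ρ` lies in that of `σ`, the function
`ψ` is continuous on `[0,1]`, so that this supremum is a maximum. -/
def phi {ι : Type*} [Fintype ι] [DecidableEq ι] (ρ σ : Matrix ι ι ℂ) (l : ℝ) : ℝ :=
  sSup ((fun s : ℝ => l * s - psi ρ σ s) '' Set.Icc 0 1)

/-- The exponential rate `limsup_{n → ∞} (1/n) log p_n`, in the extended reals,
with `log 0 = -∞`. -/
def expRate (p : ℕ → ℝ) : EReal :=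
  Filter.limsup (fun n : ℕ => ((1 / (n : ℝ) : ℝ) : EReal) * ENNReal.log (ENNReal.ofReal (p n)))
    Filter.atTop

end QuantumTesting

end

open QuantumTesting

/-! For every `s ≥ 0` and every test `A` there is a one-shot bound `Tr ρA ≤ N (Tr
ρ^{1+s}σ^{-s})^{1/(1+s)} (Tr σA)^{s/(1+s)}` (`trace_mul_le_card_mul`), where `N` counts the blocks
of a partition of an eigenbasis of `σ` into sets of constant eigenvalue. Pinching `A` along these
blocks costs the factor `N`, leaves `Tr σA` unchanged, and makes `A` commute with `σ`; what remains
is Hölder's inequality for the overlaps of two orthonormal bases. For `σ^{⊗n}` the blocks are the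
types of sequences, so `N ≤ (n+1)^{dim}` disappears from the exponential rate, while the Petz trace
is multiplicative. This bounds the rate for each `s` (`expRate_one_sub_errFirst_le`). The equation
for `λ*` is elementary: with `m = r - λ`, the terms `(r-m)s - ψ(s) - m` and `(sr - ψ(s))/(1+s) - m`
differ by the factor `1+s > 0`. Hence `m = φ(r-m)` says exactly that `m` is the maximum in the
closed formula (`isGreatest_legendre_iff`), which gives existence, uniqueness and the formula
together. -/

namespace QuantumTesting

open scoped ComplexOrder
open Matrix

/-! ### Diagonalized operators and traces of their products. -/

section Spectral

variable {κ : Type*} [Fintype κ] [DecidableEq κ]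

/-- The operator `U diag(p) U*`. -/
noncomputable def conjDiag (U : Matrix κ κ ℂ) (p : κ → ℝ) : Matrix κ κ ℂ :=
  U * diagonal (fun i => (p i : ℂ)) * Uᴴ

theorem mul_conjDiag_mul (V U : Matrix κ κ ℂ) (p : κ → ℝ) :
    V * conjDiag U p * Vᴴ = conjDiag (V * U) p := by
  simp [conjDiag, conjTranspose_mul, Matrix.mul_assoc]

theorem trace_diagonal_mul_conj_diagonal (X : Matrix κ κ ℂ) (p q : κ → ℝ) :
    (diagonal (fun i => (p i : ℂ)) * (X * diagonal (fun i => (q i : ℂ)) * Xᴴ)).trace =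
      ((∑ x, ∑ y, p x * q y * ‖X x y‖ ^ 2 : ℝ) : ℂ) := by
  simp only [trace, diag_apply, diagonal_mul]
  push_cast
  refine Finset.sum_congr rfl fun x _ => ?_
  rw [mul_apply, Finset.mul_sum]
  refine Finset.sum_congr rfl fun y _ => ?_
  rw [mul_diagonal, conjTranspose_apply, ← Complex.mul_conj', RCLike.star_def]
  ring

theorem trace_conjDiag_mul_conjDiag (U V : Matrix κ κ ℂ) (p q : κ → ℝ) :
    (conjDiag U p * conjDiag V q).trace =
      ((∑ x, ∑ y, p x * q y * ‖(Uᴴ * V) x y‖ ^ 2 : ℝ) : ℂ) := by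
  rw [← trace_diagonal_mul_conj_diagonal, conjDiag, Matrix.mul_assoc, Matrix.mul_assoc,
    trace_mul_comm]
  simp [conjDiag, conjTranspose_mul, Matrix.mul_assoc]

theorem sum_norm_sq_col {X : Matrix κ κ ℂ} (hX : X ∈ unitaryGroup κ ℂ) (i : κ) :
    ∑ x, ‖X x i‖ ^ 2 = 1 := by
  have h := congrFun (congrFun (mem_unitaryGroup_iff'.1 hX) i) i
  rw [star_eq_conjTranspose, mul_apply] at h
  simp only [conjTranspose_apply, one_apply_eq, RCLike.star_def, Complex.conj_mul'] at h
  exact_mod_cast h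

theorem exists_conjDiag_of_posSemidef {ρ : Matrix κ κ ℂ} (h : ρ.PosSemidef) :
    ∃ U ∈ unitaryGroup κ ℂ, ∃ p : κ → ℝ, 0 ≤ p ∧ ρ = conjDiag U p ∧
      ∀ t, mpow ρ t = conjDiag U (fun i => p i ^ t) := by
  refine ⟨h.1.eigenvectorUnitary, h.1.eigenvectorUnitary.2, h.1.eigenvalues,
    fun i => h.eigenvalues_nonneg i, ?_, fun t => ?_⟩
  · exact h.1.spectral_theorem
  · rw [mpow, h.1.cfc_eq]; rfl

theorem conjDiag_posSemidef {U : Matrix κ κ ℂ} {p : κ → ℝ} (hp : 0 ≤ p) :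
    (conjDiag U p).PosSemidef := by
  refine PosSemidef.mul_mul_conjTranspose_same (PosSemidef.diagonal fun i => ?_) U
  simpa using hp i

theorem nonneg_of_conjDiag_posSemidef {U : Matrix κ κ ℂ} (hU : U ∈ unitaryGroup κ ℂ) {p : κ → ℝ}
    (h : (conjDiag U p).PosSemidef) : 0 ≤ p := by
  have h2 := h.conjTranspose_mul_mul_same U
  have h3 : Uᴴ * U = 1 := mem_unitaryGroup_iff'.1 hU
  have : Uᴴ * conjDiag U p * U = diagonal (fun i => (p i : ℂ)) := by
    rw [conjDiag]
    calc _ = (Uᴴ * U) * diagonal (fun i => (p i : ℂ)) * (Uᴴ * U) := by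
          simp only [Matrix.mul_assoc]
      _ = _ := by simp [h3]
  rw [this, posSemidef_diagonal_iff] at h2
  intro i
  simpa using h2 i

theorem one_sub_conjDiag {U : Matrix κ κ ℂ} (hU : U ∈ unitaryGroup κ ℂ) (p : κ → ℝ) :
    1 - conjDiag U p = conjDiag U (1 - p) := by
  have h3 : U * Uᴴ = 1 := mem_unitaryGroup_iff.1 hU
  have : diagonal (fun i => (((1 - p) i : ℝ) : ℂ)) = 1 - diagonal (fun i => (p i : ℂ)) := by
    rw [← diagonal_one, diagonal_sub]; simp
  rw [conjDiag, conjDiag, this, Matrix.mul_sub, Matrix.sub_mul, Matrix.mul_one, h3]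

theorem trace_mul_nonneg_of_posSemidef {A B : Matrix κ κ ℂ} (hA : A.PosSemidef) (hB : B.PosSemidef) :
    0 ≤ (A * B).trace := by
  obtain ⟨U, hU, p, hp, rfl, -⟩ := exists_conjDiag_of_posSemidef hA
  obtain ⟨V, hV, q, hq, rfl, -⟩ := exists_conjDiag_of_posSemidef hB
  rw [trace_conjDiag_mul_conjDiag, Complex.zero_le_real]
  exact Finset.sum_nonneg fun x _ => Finset.sum_nonneg fun y _ =>
    mul_nonneg (mul_nonneg (hp x) (hq y)) (sq_nonneg _)

end Spectral

/-! ### Pinching along the fibres of an index map. -/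

section Pinching

variable {κ J : Type*} [DecidableEq κ] [DecidableEq J]

/-- The block-diagonal part of `A` with respect to the partition of the indices by `f`. -/
def pinch (f : κ → J) (A : Matrix κ κ ℂ) : Matrix κ κ ℂ :=
  Matrix.of fun x y => if f x = f y then A x y else 0

/-- The coordinate projection onto the fibre of `f` over `j`. -/
def fiberProj (f : κ → J) (j : J) : Matrix κ κ ℂ :=
  diagonal fun x => if f x = j then 1 else 0

theorem conjTranspose_fiberProj (f : κ → J) (j : J) : (fiberProj f j)ᴴ = fiberProj f j := by
  rw [fiberProj, diagonal_conjTranspose]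
  congr 1
  ext x
  by_cases h : f x = j <;> simp [h]

theorem sum_fiberProj [Fintype J] (f : κ → J) : ∑ j, fiberProj f j = 1 := by
  ext x y
  rw [Matrix.sum_apply]
  by_cases h : x = y
  · subst h; simp [fiberProj]
  · simp [fiberProj, h]

theorem sum_fiberProj_mul_mul [Fintype κ] [Fintype J] (f : κ → J) (A : Matrix κ κ ℂ) :
    ∑ j, fiberProj f j * A * fiberProj f j = pinch f A := by
  ext x y
  rw [Matrix.sum_apply]
  simp only [fiberProj, mul_diagonal, diagonal_mul, pinch, of_apply]
  by_cases h : f x = f y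
  · simp [h]
  · simp only [if_neg h]
    refine Finset.sum_eq_zero fun j _ => ?_
    by_cases h1 : f x = j
    · have h2 : f y ≠ j := fun h2 => h (h1.trans h2.symm)
      simp [h2]
    · simp [h1]

theorem pinch_posSemidef [Fintype κ] [Fintype J] (f : κ → J) {A : Matrix κ κ ℂ} (hA : A.PosSemidef) :
    (pinch f A).PosSemidef := by
  rw [← sum_fiberProj_mul_mul]
  refine posSemidef_sum _ fun j _ => ?_
  have := hA.mul_mul_conjTranspose_same (fiberProj f j)
  rwa [conjTranspose_fiberProj] at this

theorem one_sub_pinch (f : κ → J) (A : Matrix κ κ ℂ) : 1 - pinch f A = pinch f (1 - A) := by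
  ext x y
  by_cases h : x = y
  · subst h; simp [pinch]
  · by_cases h' : f x = f y <;> simp [pinch, h, h']

/-- The pinching inequality `A ≤ |J| • pinch A`. -/
theorem card_smul_pinch_sub_posSemidef [Fintype κ] [Fintype J] (f : κ → J) {A : Matrix κ κ ℂ} (hA : A.PosSemidef) :
    ((Fintype.card J : ℝ) • pinch f A - A).PosSemidef := by
  -- In the expanded double sum the square terms give `2|J| • pinch f A`; the cross terms give `2 •
  -- A` because the projections sum to `1`.
  have key : (Fintype.card J : ℝ) • pinch f A - A = (1 / 2 : ℝ) •
      ∑ j, ∑ k, (fiberProj f j - fiberProj f k) * A * (fiberProj f j - fiberProj f k) := by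
    have h1 : ∀ j k, (fiberProj f j - fiberProj f k) * A * (fiberProj f j - fiberProj f k) =
        fiberProj f j * A * fiberProj f j + fiberProj f k * A * fiberProj f k -
        (fiberProj f j * A * fiberProj f k + fiberProj f k * A * fiberProj f j) := by
      intro j k; noncomm_ring
    simp only [h1, Finset.sum_add_distrib, Finset.sum_sub_distrib, Finset.sum_const,
      sum_fiberProj_mul_mul, ← Finset.mul_sum, ← Finset.sum_mul, sum_fiberProj,
      Finset.card_univ, ← Finset.smul_sum, Matrix.one_mul, Matrix.mul_one]
    rw [← Nat.cast_smul_eq_nsmul ℝ]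
    module
  rw [key]
  refine PosSemidef.smul (posSemidef_sum _ fun j _ => posSemidef_sum _ fun k _ => ?_) (by norm_num)
  have := hA.mul_mul_conjTranspose_same (fiberProj f j - fiberProj f k)
  rwa [conjTranspose_sub, conjTranspose_fiberProj, conjTranspose_fiberProj] at this

/-- A pinched Hermitian matrix is diagonalized by a unitary matrix with the same blocks. -/
theorem exists_blockUnitary_pinch_eq [Fintype κ] [Fintype J] (f : κ → J) {A : Matrix κ κ ℂ} (hA : A.PosSemidef) :
    ∃ E ∈ unitaryGroup κ ℂ, ∃ a : κ → ℝ, pinch f A = conjDiag E a ∧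
      ∀ x y, f x ≠ f y → E x y = 0 := by
  let B : ∀ j : J, Matrix {x // f x = j} {x // f x = j} ℂ := fun j => A.submatrix (↑) (↑)
  have hB : ∀ j, (B j).PosSemidef := fun j => hA.submatrix _
  choose U hU p _ hBU _ using fun j => exists_conjDiag_of_posSemidef (hB j)
  let e := (Equiv.sigmaFiberEquiv f).symm
  have he : ∀ x, e x = ⟨f x, x, rfl⟩ := fun x => rfl
  have h1 : (blockDiagonal' U) * (blockDiagonal' U)ᴴ = 1 := by
    rw [blockDiagonal'_conjTranspose, ← blockDiagonal'_mul, ← blockDiagonal'_one]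
    congr 1
    ext1 j
    exact mem_unitaryGroup_iff.1 (hU j)
  have h2 : blockDiagonal' B = blockDiagonal' U *
      diagonal (fun i => (p i.1 i.2 : ℂ)) * (blockDiagonal' U)ᴴ := by
    have : diagonal (fun i : (j : J) × {x // f x = j} => (p i.1 i.2 : ℂ)) =
        blockDiagonal' fun j => diagonal fun i => (p j i : ℂ) := by
      rw [blockDiagonal'_diagonal]
    rw [this, blockDiagonal'_conjTranspose, ← blockDiagonal'_mul, ← blockDiagonal'_mul]
    congr 1
    ext1 j
    exact hBU j
  refine ⟨(blockDiagonal' U).submatrix e e, ?_, fun x => p (e x).1 (e x).2, ?_, ?_⟩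
  · rw [mem_unitaryGroup_iff, star_eq_conjTranspose, conjTranspose_submatrix,
      submatrix_mul_equiv, h1, submatrix_one_equiv]
  · have h3 := congrArg (fun M => M.submatrix e e) h2
    rw [conjDiag]
    have h4 : diagonal (fun x => (p (e x).1 (e x).2 : ℂ)) =
        (diagonal (fun i : (j : J) × {x // f x = j} => (p i.1 i.2 : ℂ))).submatrix e e := by
      rw [submatrix_diagonal_equiv]; rfl
    rw [h4, conjTranspose_submatrix, submatrix_mul_equiv, submatrix_mul_equiv, ← h2]
    ext x y
    simp only [pinch, of_apply, submatrix_apply, he]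
    by_cases h : f x = f y
    · rw [if_pos h]
      have : (⟨f x, x, rfl⟩ : (j : J) × {x // f x = j}) = ⟨f y, x, h⟩ := by
        apply (Equiv.sigmaFiberEquiv f).injective; rfl
      rw [this, blockDiagonal'_apply_eq]; rfl
    · rw [if_neg h, blockDiagonal'_apply_ne]
      exact h
  · intro x y h
    rw [submatrix_apply, he, he, blockDiagonal'_apply_ne]
    exact h

/-- A block matrix commutes with any diagonal that is constant on blocks. Thus the eigenbasis of a
pinched test still diagonalizes `σ`. -/
theorem conjDiag_comp_of_block [Fintype κ] (f : κ → J) {E : Matrix κ κ ℂ} (hE : E ∈ unitaryGroup κ ℂ)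
    (hf : ∀ x y, f x ≠ f y → E x y = 0) (q : J → ℝ) :
    conjDiag E (fun x => q (f x)) = diagonal (fun x => (q (f x) : ℂ)) := by
  have h3 : E * Eᴴ = 1 := mem_unitaryGroup_iff.1 hE
  have : E * diagonal (fun x => (q (f x) : ℂ)) = diagonal (fun x => (q (f x) : ℂ)) * E := by
    ext x y
    rw [mul_diagonal, diagonal_mul]
    by_cases h : f x = f y
    · rw [h, mul_comm]
    · rw [hf x y h]; simp
  rw [conjDiag, this, Matrix.mul_assoc, h3, Matrix.mul_one]

theorem trace_diagonal_mul_pinch [Fintype κ] (f : κ → J) (A : Matrix κ κ ℂ) (d : κ → ℂ) :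
    (diagonal d * pinch f A).trace = (diagonal d * A).trace := by
  simp [trace, diagonal_mul, pinch]

end Pinching

/-! ### The one-shot converse: pinching and Hölder. -/

section OneShot

/-- Hölder with exponent `1 + s` for the likelihood ratio `p / q` under the weight `q * a * w`,
whose total mass is `∑ q * a`. The leftover factor `a ≤ 1` is dropped. -/
theorem sum_le_rpow_mul_rpow {κ : Type*} [Fintype κ] {p q a : κ → ℝ} {w : κ → κ → ℝ} (hp : 0 ≤ p)
    (hq : 0 ≤ q) (ha : 0 ≤ a) (ha1 : a ≤ 1) (hw : ∀ x y, 0 ≤ w x y) (hw1 : ∀ y, ∑ x, w x y = 1)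
    (hpq : ∀ x y, q y = 0 → p x ≠ 0 → w x y = 0) {s : ℝ} (hs : 0 ≤ s) :
    ∑ x, ∑ y, p x * a y * w x y ≤
      (∑ x, ∑ y, p x ^ (1 + s) * q y ^ (-s) * w x y) ^ (1 / (1 + s)) *
        (∑ y, q y * a y) ^ (s / (1 + s)) := by
  have hs1 : 0 < 1 + s := by linarith
  have H := Real.inner_le_weight_mul_Lp_of_nonneg (Finset.univ : Finset (κ × κ)) (p := 1 + s)
    (by linarith) (fun z => q z.2 * a z.2 * w z.1 z.2) (fun z => p z.1 / q z.2)
    (fun z => mul_nonneg (mul_nonneg (hq _) (ha _)) (hw _ _))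
    (fun z => div_nonneg (hp _) (hq _))
  have e1 : 1 - (1 + s)⁻¹ = s / (1 + s) := by field_simp; ring
  have hW : ∑ z : κ × κ, q z.2 * a z.2 * w z.1 z.2 = ∑ y, q y * a y := by
    rw [Fintype.sum_prod_type_right]
    refine Finset.sum_congr rfl fun y _ => ?_
    dsimp only
    rw [← Finset.mul_sum, hw1, mul_one]
  rw [e1, hW, mul_comm, ← one_div] at H
  have hL : ∑ x, ∑ y, p x * a y * w x y =
      ∑ z : κ × κ, q z.2 * a z.2 * w z.1 z.2 * (p z.1 / q z.2) := by
    rw [Fintype.sum_prod_type]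
    refine Finset.sum_congr rfl fun x _ => Finset.sum_congr rfl fun y _ => ?_
    dsimp only
    -- With `p x / 0 = 0` the right-hand term vanishes; `hpq` makes the left-hand one vanish too.
    by_cases h : q y = 0
    · by_cases h' : p x = 0
      · simp [h']
      · simp [hpq x y h h']
    · field_simp
  rw [hL]
  refine H.trans (mul_le_mul_of_nonneg_right ?_ (Real.rpow_nonneg
    (Finset.sum_nonneg fun y _ => mul_nonneg (hq y) (ha y)) _))
  refine Real.rpow_le_rpow (Finset.sum_nonneg fun z _ => ?_) ?_ (by positivity)
  · exact mul_nonneg (mul_nonneg (mul_nonneg (hq _) (ha _)) (hw _ _))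
      (Real.rpow_nonneg (div_nonneg (hp _) (hq _)) _)
  rw [Fintype.sum_prod_type]
  refine Finset.sum_le_sum fun x _ => Finset.sum_le_sum fun y _ => ?_
  dsimp only
  have hnn : 0 ≤ p x ^ (1 + s) * q y ^ (-s) * w x y :=
    mul_nonneg (mul_nonneg (Real.rpow_nonneg (hp _) _) (Real.rpow_nonneg (hq _) _)) (hw _ _)
  rcases (hq y).eq_or_lt with h | h
  · have h0 : q y = 0 := h.symm
    rw [h0] at hnn ⊢
    simpa using hnn
  · have e2 : q y * a y * w x y * (p x / q y) ^ (1 + s) =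
        a y * (p x ^ (1 + s) * q y ^ (-s) * w x y) := by
      rw [Real.div_rpow (hp x) (hq y), Real.rpow_add h, Real.rpow_one, Real.rpow_neg (hq y)]
      have := (Real.rpow_pos_of_pos h s).ne'
      have hq0 : q y ≠ 0 := h.ne'
      field_simp
    rw [e2]
    exact mul_le_of_le_one_left hnn (ha1 y)

variable {κ J : Type*} [Fintype κ] [DecidableEq κ] [Fintype J] [DecidableEq J]

/-- A one-shot converse inequality: the acceptance probability of a test under `U diag(p) U*`
in terms of its acceptance probability under `V diag(q) V*`, up to the number of blocks. -/
theorem trace_mul_le_card_mul (f : κ → J) {q : J → ℝ} (hq : 0 ≤ q) {U V : Matrix κ κ ℂ}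
    (hU : U ∈ unitaryGroup κ ℂ) (hV : V ∈ unitaryGroup κ ℂ) {p : κ → ℝ} (hp : 0 ≤ p)
    (hpq : ∀ x y, q (f y) = 0 → p x ≠ 0 → (Uᴴ * V) x y = 0)
    {A : Matrix κ κ ℂ} (hA : IsTest A) {s : ℝ} (hs : 0 ≤ s) :
    ((conjDiag U p * A).trace).re ≤ Fintype.card J *
      (((conjDiag U (fun x => p x ^ (1 + s)) *
          conjDiag V (fun y => q (f y) ^ (-s))).trace).re ^ (1 / (1 + s)) *
        ((conjDiag V (fun y => q (f y)) * A).trace).re ^ (s / (1 + s))) := by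
  have hV1 : V * Vᴴ = 1 := mem_unitaryGroup_iff.1 hV
  have hV2 : Vᴴ * V = 1 := mem_unitaryGroup_iff'.1 hV
  have hVV : ∀ B : Matrix κ κ ℂ, V * (Vᴴ * B * V) * Vᴴ = B := fun B => by
    calc _ = (V * Vᴴ) * B * (V * Vᴴ) := by simp only [Matrix.mul_assoc]
      _ = B := by rw [hV1, Matrix.one_mul, Matrix.mul_one]
  -- `B` is the test in the eigenbasis of `σ`, where the blocks of `f` are coordinate blocks.
  set B := Vᴴ * A * V with hB
  have hB0 : B.PosSemidef := hA.1.conjTranspose_mul_mul_same V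
  have hB1 : (1 - B).PosSemidef := by
    have := hA.2.conjTranspose_mul_mul_same V
    rwa [Matrix.mul_sub, Matrix.sub_mul, Matrix.mul_one, hV2] at this
  obtain ⟨E, hE, a, hEa, hEf⟩ := exists_blockUnitary_pinch_eq f hB0
  have ha : 0 ≤ a := nonneg_of_conjDiag_posSemidef hE (hEa ▸ pinch_posSemidef f hB0)
  have ha1 : a ≤ 1 := by
    have h := pinch_posSemidef f hB1
    rw [← one_sub_pinch, hEa, one_sub_conjDiag hE] at h
    exact sub_nonneg.1 (nonneg_of_conjDiag_posSemidef hE h)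
  have hVE : V * E ∈ unitaryGroup κ ℂ := mul_mem hV hE
  have hcomp : ∀ g : J → ℝ, conjDiag V (fun y => g (f y)) = conjDiag (V * E) (fun y => g (f y)) := by
    intro g
    rw [← mul_conjDiag_mul, conjDiag_comp_of_block f hE hEf g]; rfl
  have hle : ((conjDiag U p * A).trace).re ≤
      Fintype.card J * ((conjDiag U p * conjDiag (V * E) a).trace).re := by
    have h1 := (card_smul_pinch_sub_posSemidef f hB0).mul_mul_conjTranspose_same V
    rw [Matrix.mul_sub, Matrix.sub_mul, hVV, hEa, Matrix.mul_smul, Matrix.smul_mul,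
      mul_conjDiag_mul] at h1
    have h2 := trace_mul_nonneg_of_posSemidef (conjDiag_posSemidef (U := U) hp) h1
    rw [Matrix.mul_sub, trace_sub, Matrix.mul_smul, trace_smul] at h2
    have h3 := (Complex.le_def.1 h2).1
    simpa using h3
  have hσA : ((conjDiag V (fun y => q (f y)) * A).trace).re = ∑ y, q (f y) * a y := by
    have h1 : (conjDiag V (fun y => q (f y)) * A).trace =
        (conjDiag E (fun y => q (f y)) * conjDiag E a).trace := by
      rw [← hEa, conjDiag_comp_of_block f hE hEf q, trace_diagonal_mul_pinch, hB, conjDiag,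
        Matrix.mul_assoc, Matrix.mul_assoc, trace_mul_comm]
      simp only [Matrix.mul_assoc]
    have hE2 : Eᴴ * E = 1 := mem_unitaryGroup_iff'.1 hE
    rw [h1, trace_conjDiag_mul_conjDiag, Complex.ofReal_re, hE2]
    refine Finset.sum_congr rfl fun x _ => ?_
    rw [Finset.sum_eq_single x]
    · simp
    · intro y _ hy; simp [one_apply_ne hy.symm]
    · simp
  rw [hσA, hcomp (fun j => q j ^ (-s)), trace_conjDiag_mul_conjDiag, Complex.ofReal_re]
  refine hle.trans (mul_le_mul_of_nonneg_left ?_ (Nat.cast_nonneg _))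
  rw [trace_conjDiag_mul_conjDiag, Complex.ofReal_re]
  have hX : Uᴴ * (V * E) ∈ unitaryGroup κ ℂ := mul_mem (Unitary.star_mem hU) hVE
  refine sum_le_rpow_mul_rpow hp (fun y => hq (f y)) ha ha1 (fun x y => sq_nonneg _)
    (fun y => sum_norm_sq_col hX y) (fun x y h0 hne => ?_) hs
  have : (Uᴴ * (V * E)) x y = 0 := by
    rw [← Matrix.mul_assoc, mul_apply]
    refine Finset.sum_eq_zero fun z _ => ?_
    by_cases hz : f z = f y
    · rw [hpq x z (by rw [hz, h0]) hne, zero_mul]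
    · rw [hEf z y hz, mul_zero]
  simp [this]

end OneShot

/-! ### Tensor powers and types of sequences. -/

section TensorPow

variable {ι : Type*}

theorem tensorPow_mul [Fintype ι] (A B : Matrix ι ι ℂ) (n : ℕ) :
    tensorPow (A * B) n = tensorPow A n * tensorPow B n := by
  classical
  ext x y
  simp only [tensorPow, of_apply, mul_apply]
  rw [Finset.prod_univ_sum, Fintype.piFinset_univ]
  exact Finset.sum_congr rfl fun z _ => Finset.prod_mul_distrib

theorem conjTranspose_tensorPow (A : Matrix ι ι ℂ) (n : ℕ) :
    (tensorPow A n)ᴴ = tensorPow Aᴴ n := by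
  ext x y
  simp [tensorPow]

theorem trace_tensorPow [Fintype ι] (A : Matrix ι ι ℂ) (n : ℕ) :
    (tensorPow A n).trace = A.trace ^ n := by
  rw [trace, trace, Fintype.sum_pow]
  rfl

variable [DecidableEq ι]

theorem tensorPow_diagonal (d : ι → ℂ) (n : ℕ) :
    tensorPow (diagonal d) n = diagonal fun x => ∏ k, d (x k) := by
  ext x y
  rw [tensorPow, of_apply]
  by_cases h : x = y
  · subst h; simp
  · rw [diagonal_apply_ne _ h]
    obtain ⟨k, hk⟩ := Function.ne_iff.1 h
    exact Finset.prod_eq_zero (Finset.mem_univ k) (diagonal_apply_ne _ hk)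

theorem tensorPow_one (n : ℕ) : tensorPow (1 : Matrix ι ι ℂ) n = 1 := by
  rw [← diagonal_one, tensorPow_diagonal]
  simp

variable [Fintype ι]

theorem tensorPow_conjDiag (U : Matrix ι ι ℂ) (p : ι → ℝ) (n : ℕ) :
    tensorPow (conjDiag U p) n = conjDiag (tensorPow U n) fun x => ∏ k, p (x k) := by
  rw [conjDiag, tensorPow_mul, tensorPow_mul, tensorPow_diagonal, conjDiag,
    conjTranspose_tensorPow]
  simp

theorem tensorPow_mem_unitaryGroup {U : Matrix ι ι ℂ} (hU : U ∈ unitaryGroup ι ℂ) (n : ℕ) :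
    tensorPow U n ∈ unitaryGroup (Fin n → ι) ℂ := by
  rw [mem_unitaryGroup_iff, star_eq_conjTranspose, conjTranspose_tensorPow, ← tensorPow_mul,
    ← star_eq_conjTranspose, mem_unitaryGroup_iff.1 hU, tensorPow_one]

/-- The type of a sequence: how often each letter occurs. -/
def letterCount (n : ℕ) (x : Fin n → ι) (i : ι) : Fin (n + 1) :=
  ⟨(Finset.univ.filter fun k => x k = i).card,
    Nat.lt_succ_of_le ((Finset.card_le_univ _).trans_eq (Fintype.card_fin n))⟩

/-- Eigenvalues of `σ^{⊗n}` depend only on the type, so `letterCount n` can serve as the block map,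
with only polynomially many blocks. -/
theorem prod_pow_letterCount (q : ι → ℝ) (n : ℕ) (x : Fin n → ι) :
    ∏ i, q i ^ (letterCount n x i : ℕ) = ∏ k, q (x k) := by
  rw [← Finset.prod_fiberwise' Finset.univ x q]
  simp [letterCount]

end TensorPow

/-! ### Eigenvector overlaps under the support condition. -/

section Support

variable {ι : Type*} [Fintype ι] [DecidableEq ι]

/-- An eigenvector of `ρ` with nonzero eigenvalue lies in the image of `σ`, hence is orthogonal to
its kernel. -/
theorem ImageLE.overlap_eq_zero {U V : Matrix ι ι ℂ} {p q : ι → ℝ} (hU : U ∈ unitaryGroup ι ℂ)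
    (hV : V ∈ unitaryGroup ι ℂ) (h : ImageLE (conjDiag U p) (conjDiag V q)) {x y : ι}
    (hq : q y = 0) (hp : p x ≠ 0) : (Uᴴ * V) x y = 0 := by
  have hU2 : Uᴴ * U = 1 := mem_unitaryGroup_iff'.1 hU
  have hV2 : Vᴴ * V = 1 := mem_unitaryGroup_iff'.1 hV
  obtain ⟨z, hz⟩ := h (LinearMap.mem_range_self _ (U *ᵥ Pi.single x 1))
  simp only [mulVecLin_apply, mulVec_mulVec] at hz
  have h1 := congrFun (congrArg (fun v => Vᴴ *ᵥ v) hz) y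
  simp only [mulVec_mulVec] at h1
  have e1 : Vᴴ * conjDiag V q = diagonal (fun i => (q i : ℂ)) * Vᴴ := by
    rw [conjDiag, ← Matrix.mul_assoc, ← Matrix.mul_assoc, hV2, Matrix.one_mul]
  have e2 : Vᴴ * (conjDiag U p * U) = Vᴴ * U * diagonal (fun i => (p i : ℂ)) := by
    rw [conjDiag, Matrix.mul_assoc, hU2, Matrix.mul_one, Matrix.mul_assoc]
  rw [e1, e2, ← mulVec_mulVec, mulVec_diagonal, hq, mulVec_single_one, col_apply,
    mul_diagonal] at h1
  have h2 : (Vᴴ * U) y x = 0 := by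
    have hp' : (p x : ℂ) ≠ 0 := by exact_mod_cast hp
    simpa [hp'] using h1.symm
  have h3 : Uᴴ * V = (Vᴴ * U)ᴴ := by simp
  rw [h3, conjTranspose_apply, h2, star_zero]

end Support

/-! ### The bound at block length `n`; positivity of the Petz trace and continuity of `psi`. -/

section Converse

variable {ι : Type*} [Fintype ι] [DecidableEq ι]

/-- `Tr ρ^{1+s} σ^{-s}`. -/
noncomputable def petzTrace (ρ σ : Matrix ι ι ℂ) (s : ℝ) : ℝ :=
  ((mpow ρ (1 + s) * mpow σ (-s)).trace).re

theorem errSecond_nonneg {σ : Matrix ι ι ℂ} (hσ : IsDensity σ) {n : ℕ}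
    {A : Matrix (Fin n → ι) (Fin n → ι) ℂ} (hA : IsTest A) : 0 ≤ errSecond σ n A := by
  obtain ⟨V, hV, q, hq, rfl, -⟩ := exists_conjDiag_of_posSemidef hσ.1
  rw [errSecond, tensorPow_conjDiag]
  exact (Complex.le_def.1 (trace_mul_nonneg_of_posSemidef (conjDiag_posSemidef
    fun x => Finset.prod_nonneg fun k _ => hq _) hA.1)).1

theorem one_sub_errFirst {ρ : Matrix ι ι ℂ} (hρ : IsDensity ρ) {n : ℕ}
    (A : Matrix (Fin n → ι) (Fin n → ι) ℂ) :
    1 - errFirst ρ n A = ((tensorPow ρ n * A).trace).re := by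
  rw [errFirst, Matrix.mul_sub, Matrix.mul_one, trace_sub, trace_tensorPow, hρ.2]
  simp

variable {ρ σ : Matrix ι ι ℂ}

theorem one_sub_errFirst_le (hρ : IsDensity ρ) (hσ : IsDensity σ) (hsupp : ImageLE ρ σ) {n : ℕ}
    {A : Matrix (Fin n → ι) (Fin n → ι) ℂ} (hA : IsTest A) {s : ℝ} (hs : 0 ≤ s) :
    1 - errFirst ρ n A ≤ (n + 1 : ℝ) ^ Fintype.card ι *
      ((petzTrace ρ σ s ^ n) ^ (1 / (1 + s)) * errSecond σ n A ^ (s / (1 + s))) := by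
  rw [one_sub_errFirst hρ, errSecond, petzTrace]
  obtain ⟨U, hU, p, hp, rfl, hρt⟩ := exists_conjDiag_of_posSemidef hρ.1
  obtain ⟨V, hV, q, hq, rfl, hσt⟩ := exists_conjDiag_of_posSemidef hσ.1
  have H := trace_mul_le_card_mul (letterCount n)
    (q := fun c : ι → Fin (n + 1) => ∏ i, q i ^ (c i : ℕ))
    (fun c => Finset.prod_nonneg fun i _ => pow_nonneg (hq i) _)
    (tensorPow_mem_unitaryGroup hU n) (tensorPow_mem_unitaryGroup hV n)
    (p := fun x => ∏ k, p (x k)) (fun x => Finset.prod_nonneg fun k _ => hp _)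
    (fun x y h0 hne => by
      rw [prod_pow_letterCount] at h0
      obtain ⟨k, -, hk⟩ := Finset.prod_eq_zero_iff.1 h0
      rw [conjTranspose_tensorPow, ← tensorPow_mul, tensorPow, of_apply]
      exact Finset.prod_eq_zero (Finset.mem_univ k) (hsupp.overlap_eq_zero hU hV hk
        (Finset.prod_ne_zero_iff.1 hne k (Finset.mem_univ k)))) hA hs
  simp only [prod_pow_letterCount] at H
  have e1 : ∀ x : Fin n → ι, (∏ k, p (x k)) ^ (1 + s) = ∏ k, p (x k) ^ (1 + s) := fun x =>
    (Real.finsetProd_rpow _ _ (fun k _ => hp _) _).symm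
  have e2 : ∀ x : Fin n → ι, (∏ k, q (x k)) ^ (-s) = ∏ k, q (x k) ^ (-s) := fun x =>
    (Real.finsetProd_rpow _ _ (fun k _ => hq _) _).symm
  simp only [e1, e2] at H
  rw [← tensorPow_conjDiag U p, ← tensorPow_conjDiag V q,
    ← tensorPow_conjDiag U fun i => p i ^ (1 + s), ← tensorPow_conjDiag V fun i => q i ^ (-s),
    ← tensorPow_mul (conjDiag U fun i => p i ^ (1 + s)), trace_tensorPow] at H
  rw [hρt, hσt]
  rw [trace_conjDiag_mul_conjDiag, ← Complex.ofReal_pow, Complex.ofReal_re] at H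
  rw [trace_conjDiag_mul_conjDiag, Complex.ofReal_re]
  simpa using H

theorem petzTrace_pos (hρ : IsDensity ρ) (hσ : IsDensity σ) (hsupp : ImageLE ρ σ) {s : ℝ}
    (hs : 0 ≤ s) : 0 < petzTrace ρ σ s := by
  -- For the trivial test at `n = 1`, a vanishing Petz trace would turn the bound into `1 ≤ 0`.
  have hA : IsTest (1 : Matrix (Fin 1 → ι) (Fin 1 → ι) ℂ) := by
    refine ⟨PosSemidef.one, ?_⟩
    rw [sub_self]
    exact PosSemidef.zero
  have H := one_sub_errFirst_le hρ hσ hsupp hA hs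
  have h0 : 0 ≤ petzTrace ρ σ s := by
    obtain ⟨U, hU, p, hp, rfl, hρt⟩ := exists_conjDiag_of_posSemidef hρ.1
    obtain ⟨V, hV, q, hq, rfl, hσt⟩ := exists_conjDiag_of_posSemidef hσ.1
    rw [petzTrace, hρt, hσt]
    exact (Complex.le_def.1 (trace_mul_nonneg_of_posSemidef
      (conjDiag_posSemidef fun i => Real.rpow_nonneg (hp i) _)
      (conjDiag_posSemidef fun i => Real.rpow_nonneg (hq i) _))).1
  refine h0.lt_of_ne' fun h => ?_
  have hs1 : 1 / (1 + s) ≠ 0 := by positivity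
  rw [h, one_sub_errFirst hρ, Matrix.mul_one, trace_tensorPow, hρ.2, pow_one, pow_one,
    Real.zero_rpow hs1] at H
  norm_num at H

theorem exp_psi (hρ : IsDensity ρ) (hσ : IsDensity σ) (hsupp : ImageLE ρ σ) {s : ℝ}
    (hs : 0 ≤ s) : Real.exp (psi ρ σ s) = petzTrace ρ σ s :=
  Real.exp_log (petzTrace_pos hρ hσ hsupp hs)

theorem continuousOn_psi (hρ : IsDensity ρ) (hσ : IsDensity σ) (hsupp : ImageLE ρ σ) :
    ContinuousOn (psi ρ σ) (Set.Icc 0 1) := by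
  refine ContinuousOn.log (f := petzTrace ρ σ) ?_
    fun s hs => (petzTrace_pos hρ hσ hsupp hs.1).ne'
  obtain ⟨U, hU, p, hp, rfl, hρt⟩ := exists_conjDiag_of_posSemidef hρ.1
  obtain ⟨V, hV, q, hq, rfl, hσt⟩ := exists_conjDiag_of_posSemidef hσ.1
  have : petzTrace (conjDiag U p) (conjDiag V q) = fun s : ℝ =>
      ∑ x, ∑ y, p x ^ (1 + s) * q y ^ (-s) * ‖(Uᴴ * V) x y‖ ^ 2 := by
    ext s
    rw [petzTrace, hρt, hσt, trace_conjDiag_mul_conjDiag, Complex.ofReal_re]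
  rw [this]
  refine continuousOn_finsetSum _ fun x _ => continuousOn_finsetSum _ fun y _ => ?_
  by_cases hpx : p x = 0
  · refine (continuousOn_const (c := (0 : ℝ))).congr fun s hs => ?_
    have : 1 + s ≠ 0 := by linarith [hs.1]
    simp [hpx, Real.zero_rpow this]
  -- Here `0 ^ (-s)` jumps at `s = 0`, since `0 ^ 0 = 1`; the vanishing overlap removes the term.
  by_cases hqy : q y = 0
  · simp only [hsupp.overlap_eq_zero hU hV hqy hpx, norm_zero, ne_eq, OfNat.ofNat_ne_zero,
      not_false_eq_true, zero_pow, mul_zero]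
    exact continuousOn_const
  · refine Continuous.continuousOn ?_
    exact ((Real.continuous_const_rpow hpx).comp (by fun_prop)).mul
      ((Real.continuous_const_rpow hqy).comp (by fun_prop)) |>.mul continuous_const

end Converse

open Filter

/-! ### Exponential rates as eventual bounds. -/

section Rate

theorem inv_mul_log_exp {n : ℕ} (hn : n ≠ 0) (y : ℝ) :
    ((1 / (n : ℝ) : ℝ) : EReal) * ENNReal.log (ENNReal.ofReal (Real.exp (n * y))) = (y : EReal) := by
  rw [ENNReal.log_ofReal_of_pos (Real.exp_pos _), Real.log_exp, ← EReal.coe_mul]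
  have : (n : ℝ) ≠ 0 := by exact_mod_cast hn
  congr 1
  field_simp

theorem inv_mul_log_mono (n : ℕ) {a b : ℝ} (h : a ≤ b) :
    ((1 / (n : ℝ) : ℝ) : EReal) * ENNReal.log (ENNReal.ofReal a) ≤
      ((1 / (n : ℝ) : ℝ) : EReal) * ENNReal.log (ENNReal.ofReal b) :=
  mul_le_mul_of_nonneg_left (ENNReal.log_monotone (ENNReal.ofReal_le_ofReal h))
    (by exact_mod_cast (by positivity : (0 : ℝ) ≤ 1 / (n : ℝ)))

theorem expRate_le_of_eventually {p : ℕ → ℝ} {c : ℝ}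
    (h : ∀ ε > 0, ∀ᶠ n : ℕ in atTop, p n ≤ Real.exp (n * (c + ε))) : expRate p ≤ (c : EReal) := by
  refine EReal.le_of_forall_lt_iff_le.1 fun z hz => ?_
  have hz' : c < z := by exact_mod_cast hz
  refine limsup_le_of_le (h := ?_)
  filter_upwards [h (z - c) (sub_pos.2 hz'), eventually_ne_atTop 0] with n hn hn0
  rw [add_sub_cancel] at hn
  exact (inv_mul_log_mono n hn).trans_eq (inv_mul_log_exp hn0 z)

theorem eventually_le_of_expRate_le {p : ℕ → ℝ} {c : ℝ} (h : expRate p ≤ (c : EReal)) {ε : ℝ}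
    (hε : 0 < ε) : ∀ᶠ n : ℕ in atTop, p n ≤ Real.exp (n * (c + ε)) := by
  have h1 : expRate p < ((c + ε : ℝ) : EReal) :=
    h.trans_lt (by exact_mod_cast lt_add_of_pos_right c hε)
  filter_upwards [eventually_lt_of_limsup_lt h1, eventually_ne_atTop 0] with n hn hn0
  by_contra! hlt
  exact hn.not_ge ((inv_mul_log_exp hn0 (c + ε)).symm.trans_le (inv_mul_log_mono n hlt.le))

theorem eventually_pow_le_exp (d : ℕ) {δ : ℝ} (hδ : 0 < δ) :
    ∀ᶠ n : ℕ in atTop, (n + 1 : ℝ) ^ d ≤ Real.exp (n * δ) := by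
  -- The constant `exp (-δ)` absorbs the shift from `n` to `n + 1`.
  have h := (isLittleO_pow_exp_pos_mul_atTop d hδ).def (Real.exp_pos (-δ))
  have ht : Tendsto (fun n : ℕ => (n : ℝ) + 1) atTop atTop :=
    tendsto_atTop_add_const_right _ _ tendsto_natCast_atTop_atTop
  filter_upwards [ht.eventually h] with n hn
  rw [Real.norm_of_nonneg (by positivity), Real.norm_of_nonneg (Real.exp_pos _).le,
    ← Real.exp_add] at hn
  exact hn.trans_eq (by congr 1; ring)

end Rate

/-! ### The asymptotic bound and the equation for `λ*`. -/

variable {ι : Type*} [Fintype ι] [DecidableEq ι] {ρ σ : Matrix ι ι ℂ}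

theorem expRate_one_sub_errFirst_le (hρ : IsDensity ρ) (hσ : IsDensity σ) (hsupp : ImageLE ρ σ)
    {r : ℝ} {A : (n : ℕ) → Matrix (Fin n → ι) (Fin n → ι) ℂ} (hA : ∀ n, IsTest (A n))
    (hr : expRate (fun n => errSecond σ n (A n)) ≤ ((-r : ℝ) : EReal)) {s : ℝ} (hs : 0 ≤ s) :
    expRate (fun n => 1 - errFirst ρ n (A n)) ≤
      ((-(s / (1 + s) * r - 1 / (1 + s) * psi ρ σ s) : ℝ) : EReal) := by
  refine expRate_le_of_eventually fun ε hε => ?_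
  -- One half pays for the polynomial factor, the other for the slack in the constraint on
  -- `errSecond`.
  have hε2 : 0 < ε / 2 := half_pos hε
  have hs1 : 0 < 1 + s := by linarith
  filter_upwards [eventually_le_of_expRate_le hr hε2,
    eventually_pow_le_exp (Fintype.card ι) hε2] with n h1 h2
  refine (one_sub_errFirst_le hρ hσ hsupp (hA n) hs).trans ?_
  have h3 : errSecond σ n (A n) ^ (s / (1 + s)) ≤
      Real.exp (n * (-r + ε / 2) * (s / (1 + s))) := by
    rw [Real.exp_mul]
    exact Real.rpow_le_rpow (errSecond_nonneg hσ (hA n)) h1 (by positivity)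
  have h4 : (petzTrace ρ σ s ^ n) ^ (1 / (1 + s)) =
      Real.exp (n * psi ρ σ s * (1 / (1 + s))) := by
    rw [Real.exp_mul, Real.exp_nat_mul, exp_psi hρ hσ hsupp hs]
  rw [h4]
  refine (mul_le_mul h2 (mul_le_mul_of_nonneg_left h3 (Real.exp_pos _).le)
    (mul_nonneg (Real.exp_pos _).le (Real.rpow_nonneg (errSecond_nonneg hσ (hA n)) _))
    (Real.exp_pos _).le).trans ?_
  rw [← Real.exp_add, ← Real.exp_add, Real.exp_le_exp]
  have h5 : s / (1 + s) ≤ 1 := by rw [div_le_one hs1]; linarith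
  have h6 : (n : ℝ) * (ε / 2) * (s / (1 + s)) ≤ n * (ε / 2) * 1 :=
    mul_le_mul_of_nonneg_left h5 (by positivity)
  nlinarith

theorem isGreatest_phi (hρ : IsDensity ρ) (hσ : IsDensity σ) (hsupp : ImageLE ρ σ) (l : ℝ) :
    IsGreatest ((fun s : ℝ => l * s - psi ρ σ s) '' Set.Icc 0 1) (phi ρ σ l) := by
  have hc : ContinuousOn (fun s : ℝ => l * s - psi ρ σ s) (Set.Icc 0 1) :=
    (by fun_prop : Continuous fun s : ℝ => l * s).continuousOn.sub
      (continuousOn_psi hρ hσ hsupp)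
  exact (isCompact_Icc.image_of_continuousOn hc).isGreatest_sSup
    ((Set.nonempty_Icc.2 zero_le_one).image _)

/-- Solving `m = φ(r - m)`: the greatest values of the two families of affine functions agree. -/
theorem isGreatest_legendre_iff (ψ : ℝ → ℝ) (r m : ℝ) :
    IsGreatest ((fun s : ℝ => (r - m) * s - ψ s) '' Set.Icc 0 1) m ↔
      IsGreatest ((fun s : ℝ => s / (1 + s) * r - 1 / (1 + s) * ψ s) '' Set.Icc 0 1) m := by
  have key : ∀ s ∈ Set.Icc (0 : ℝ) 1, (r - m) * s - ψ s - m =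
      (1 + s) * (s / (1 + s) * r - 1 / (1 + s) * ψ s - m) := by
    intro s hs
    have : 1 + s ≠ 0 := by linarith [hs.1]
    field_simp
    ring
  have hpos : ∀ s ∈ Set.Icc (0 : ℝ) 1, 0 < 1 + s := fun s hs => by linarith [hs.1]
  simp only [IsGreatest, mem_upperBounds, Set.forall_mem_image]
  refine and_congr (exists_congr fun s => and_congr_right fun hs => ?_)
    (forall₂_congr fun s hs => ?_)
  · rw [← sub_eq_zero, key s hs, mul_eq_zero, or_iff_right (hpos s hs).ne', sub_eq_zero]
  · rw [← sub_nonpos, key s hs, ← sub_nonpos (b := m)]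
    exact ⟨fun h => nonpos_of_mul_nonpos_right h (hpos s hs),
      mul_nonpos_of_nonneg_of_nonpos (hpos s hs).le⟩

theorem phi_eq_iff_isGreatest (hρ : IsDensity ρ) (hσ : IsDensity σ) (hsupp : ImageLE ρ σ)
    (r l : ℝ) : phi ρ σ l = r - l ↔
      IsGreatest ((fun s : ℝ => s / (1 + s) * r - 1 / (1 + s) * psi ρ σ s) '' Set.Icc 0 1)
        (r - l) := by
  rw [← isGreatest_legendre_iff, sub_sub_cancel]
  exact ⟨fun h => h ▸ isGreatest_phi hρ hσ hsupp l,
    fun h => (isGreatest_phi hρ hσ hsupp l).unique h⟩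

theorem exists_isGreatest_rate (hρ : IsDensity ρ) (hσ : IsDensity σ) (hsupp : ImageLE ρ σ)
    (r : ℝ) : ∃ m, IsGreatest
      ((fun s : ℝ => s / (1 + s) * r - 1 / (1 + s) * psi ρ σ s) '' Set.Icc 0 1) m := by
  have h1 : ∀ s ∈ Set.Icc (0 : ℝ) 1, 1 + s ≠ 0 := fun s hs => by linarith [hs.1]
  have hc : ContinuousOn (fun s : ℝ => s / (1 + s) * r - 1 / (1 + s) * psi ρ σ s)
      (Set.Icc 0 1) := by
    have hd : ContinuousOn (fun s : ℝ => 1 + s) (Set.Icc 0 1) := by fun_prop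
    exact ((continuousOn_id.div hd h1).mul continuousOn_const).sub
      ((continuousOn_const.div hd h1).mul (continuousOn_psi hρ hσ hsupp))
  exact (isCompact_Icc.image_of_continuousOn hc).exists_isGreatest
    ((Set.nonempty_Icc.2 zero_le_one).image _)

end QuantumTesting

theorem theorem3 {ι : Type*} [Fintype ι] [DecidableEq ι] (ρ σ : Matrix ι ι ℂ)
    (hρ : IsDensity ρ) (hσ : IsDensity σ) (hsupp : ImageLE ρ σ) (r : ℝ) :
    (∃! l : ℝ, phi ρ σ l = r - l) ∧
    ∀ l : ℝ, phi ρ σ l = r - l →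
      (∀ A : (n : ℕ) → Matrix (Fin n → ι) (Fin n → ι) ℂ, (∀ n, IsTest (A n)) →
        expRate (fun n => errSecond σ n (A n)) ≤ ((-r : ℝ) : EReal) →
        expRate (fun n => 1 - errFirst ρ n (A n)) ≤ ((-phi ρ σ l : ℝ) : EReal)) ∧
      IsGreatest
        ((fun s : ℝ => s / (1 + s) * r - 1 / (1 + s) * psi ρ σ s) '' Set.Icc 0 1)
        (phi ρ σ l) := by
  have hiff := phi_eq_iff_isGreatest hρ hσ hsupp r
  obtain ⟨m, hm⟩ := exists_isGreatest_rate hρ hσ hsupp r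
  refine ⟨⟨r - m, (hiff _).2 (by rwa [sub_sub_cancel]), fun l hl => ?_⟩, fun l hl => ?_⟩
  · have := ((hiff l).1 hl).unique hm
    linarith
  · have hg := (hiff l).1 hl
    rw [hl]
    refine ⟨fun A hA hr => ?_, hg⟩
    -- The rate bound holds for each `s`; a maximizer gives exactly `φ(λ*)`.
    obtain ⟨s, hs, hsl⟩ := hg.1
    rw [← hsl]
    exact expRate_one_sub_errFirst_le hρ hσ hsupp hA hr hs.1
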